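/- Let $d\ge 2$ and $N\ge 2$ be integers and let $(p_n)_{n\ge 1}$ be a non-decreasing sequence in $(0,1]$ with $\prod_{n=1}^\infty p_n>0$. Fat fractal percolation is the following random construction. For each $n\ge 1$ the unit cube $[0,1]^d$ is divided into $N^{dn}$ closed level-$n$ subcubes of side length $N^{-n}$ in the usual $N$-adic way. Attach to all subcubes of all levels $n\ge1$ independent $\{0,1\}$-valued random variables, the variable of a level-$n$ cube being $1$ with probability $p_n$. A level-$n$ cube is retained if its own variable and the variables of all the level-$k$ cubes, $1\le k<n$, in whose successive subdivision it arises are equal to $1$. Let $D^n$ be the union of the retained level-$n$ cubes and let $D=\bigcap_{n\ge 1}D^n$ be the limit set; non-extinction is the event $\{D\ne\emptyset\}$. Let $D^{\mathrm d}$ be the set of points $x\in D$ whose connected component in $D$ is $\{x\}$ (the dust set), let $D^{\mathrm c}=D\setminus D^{\mathrm d}$, and let $\lambda$ denote $d$-dimensional Lebesgue measure. Then exactly one of the following two statements holds: (1) almost surely given non-extinction, $\lambda(D^{\mathrm d})=0$ and $\lambda(D^{\mathrm c})>0$; (2) almost surely given non-extinction, $\lambda(D^{\mathrm d})>0$ and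 $\lambda(D^{\mathrm c})=0$. -/

import Mathlib

namespace FatFractal

open MeasureTheory

/-- The set `J^{d,n}` of words of length `n` over the alphabet `J^d = {0, …, N - 1}^d`.
They index the level-`n` subcubes of the unit cube. -/
abbrev Word (N d n : ℕ) : Type := Fin n → Fin d → Fin N

/-- The lower corner of the level-`n` cube with index `I = (i_1, …, i_n)`: its `l`-th coordinate is
`∑_{j=1}^n N^{-j} i_{j,l}` (the Lean index `j : Fin n` runs from `0` to `n - 1`). -/
noncomputable def corner {N d n : ℕ} (I : Word N d n) : Fin d → ℝ :=
  fun l => ∑ j : Fin n, ((I j l : ℕ) : ℝ) / (N : ℝ) ^ ((j : ℕ) + 1)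

/-- The closed level-`n` cube `C(I) = c(I) + [0, N^{-n}]^d`. -/
noncomputable def cube {N d n : ℕ} (I : Word N d n) : Set (Fin d → ℝ) :=
  Set.Icc (corner I) (fun l => corner I l + 1 / (N : ℝ) ^ n)

/-- Indices of the subcubes of level at least one: `⟨n, I⟩` is a cube of level `n + 1`. The unit
cube itself is always retained and carries no randomness. -/
abbrev CubeIndex (N d : ℕ) : Type := Σ n : ℕ, Word N d (n + 1)

/-- A configuration: one retention variable for every subcube of level at least one. -/
abbrev Config (N d : ℕ) : Type := CubeIndex N d → Bool

/-- The law of fat fractal percolation: the retention variables are independent, and the variable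
of a level-`n` cube is `true` with probability `p n` and `false` with probability `1 - p n`
(only the values `p n` with `1 ≤ n` are used). -/
noncomputable def law (N d : ℕ) (p : ℕ → unitInterval) : Measure (Config N d) :=
  Measure.infinitePi fun I : CubeIndex N d =>
    ProbabilityTheory.bernoulliMeasure true false (p (I.1 + 1))

/-- The cube `C(I)` is retained: the retention variables of all cubes `C(i_1, …, i_{k+1})`,
`k + 1 ≤ n`, of its line of descent are `true`. -/
def Retained {N d n : ℕ} (ω : Config N d) (I : Word N d n) : Prop :=
  ∀ (k : ℕ) (hk : k + 1 ≤ n), ω ⟨k, fun j => I (Fin.castLE hk j)⟩ = true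

/-- The union `D^n` of the retained level-`n` cubes. -/
def levelSet {N d : ℕ} (ω : Config N d) (n : ℕ) : Set (Fin d → ℝ) :=
  ⋃ (I : Word N d n) (_ : Retained ω I), cube I

/-- The limit set `D = ⋂_{n ≥ 1} D^n`. -/
def limitSet {N d : ℕ} (ω : Config N d) : Set (Fin d → ℝ) :=
  ⋂ (n : ℕ) (_ : 1 ≤ n), levelSet ω n

/-- The dust set: the points of the limit set whose connected component in the limit set is a
single point. -/
def dustSet {N d : ℕ} (ω : Config N d) : Set (Fin d → ℝ) :=
  {x | x ∈ limitSet ω ∧ connectedComponentIn (limitSet ω) x = {x}}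

/-- The complement of the dust set in the limit set: the union of the connected components of the
limit set that are larger than one point. -/
def connectedSet {N d : ℕ} (ω : Config N d) : Set (Fin d → ℝ) :=
  limitSet ω \ dustSet ω

end FatFractal

/-! Fix a point `x` on no face of an `N`-adic cube, and force all cubes that contain `x` to be open.
Whether `x` can then be isolated does not depend on finitely many levels: a small separated cluster
around `x` lies inside the open level-`m` cube of `x`. By Kolmogorov's law the isolation probability
of `x` is therefore 0 or 1 (`isolationProb_eq_zero_or_one`).

Exchanging the digits of two level-`m` words permutes the cubes of every level, hence preserves the
law, and acts as a translation below these two cubes. So the isolation probability is invariant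
under translations between cubes of one level (`isolationProb_eq`), and the set where it is 1 has
the same volume in all cubes of a level. Such a set is null or conull in the unit cube
(`volume_eq_zero_or_one`).

If `x` lies in the limit set, forcing changes nothing, and isolation means that the component of `x`
is trivial (`connectedComponentIn_eq_singleton_iff`). Fubini then shows that the dust set is almost
surely null or its complement in the limit set is almost surely null.

Finally, a retained cube contains positive limit volume with conditional probability at least `c = ∏
p_n`, whatever happened up to its level. A Lévy-type zero-one argument (`ae_of_forall_mul_le`) makes
the volume positive almost surely on survival, so the part that is not null has positive volume.
Positive volume has positive probability, so the two alternatives exclude each other. -/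

namespace FatFractal

open MeasureTheory ProbabilityTheory

/-! ### `N`-adic cubes, digits and generic points -/

section Geometry

variable {N d m n : ℕ}

/-- The index of the ancestor of level `m` of a level-`n` cube. -/
abbrev Word.take (h : m ≤ n) (I : Word N d n) : Word N d m := fun j => I (Fin.castLE h j)

/-- The first `n` digits, in base `N`, of the coordinates of `x`. -/
noncomputable def word (N : ℕ) [NeZero N] (n : ℕ) (x : Fin d → ℝ) : Word N d n :=
  fun j l => Fin.ofNat N ⌊(N : ℝ) ^ ((j : ℕ) + 1) * x l⌋₊

/-- The half-open unit cube. -/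
def unitCube (d : ℕ) : Set (Fin d → ℝ) := Set.pi Set.univ fun _ => Set.Ico 0 1

/-- The half-open level-`n` cube with index `I`. -/
noncomputable def halfOpenCube (I : Word N d n) : Set (Fin d → ℝ) :=
  Set.pi Set.univ fun l => Set.Ico (corner I l) (corner I l + 1 / (N : ℝ) ^ n)

/-- The open level-`n` cube with index `I`. -/
noncomputable def openCube (I : Word N d n) : Set (Fin d → ℝ) :=
  Set.pi Set.univ fun l => Set.Ioo (corner I l) (corner I l + 1 / (N : ℝ) ^ n)

/-- The points of the unit cube that lie on no face of an `N`-adic cube. -/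
def generic (N d : ℕ) [NeZero N] : Set (Fin d → ℝ) :=
  {x | x ∈ unitCube d ∧ ∀ n, x ∈ openCube (word N n x)}

theorem corner_succ (I : Word N d (n + 1)) (l : Fin d) :
    corner I l = corner (Word.take n.le_succ I) l + (I (Fin.last n) l : ℕ) / (N : ℝ) ^ (n + 1) := by
  simp only [corner, Fin.sum_univ_castSucc]
  rfl

theorem openCube_subset_halfOpenCube (I : Word N d n) : openCube I ⊆ halfOpenCube I :=
  Set.pi_mono fun _ _ => Set.Ioo_subset_Ico_self

theorem halfOpenCube_subset_cube (I : Word N d n) : halfOpenCube I ⊆ cube I := by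
  rw [cube, ← Set.pi_univ_Icc]
  exact Set.pi_mono fun _ _ => Set.Ico_subset_Icc_self

theorem isOpen_openCube (I : Word N d n) : IsOpen (openCube I) :=
  isOpen_set_pi Set.finite_univ fun _ _ => isOpen_Ioo

theorem measurableSet_halfOpenCube (I : Word N d n) : MeasurableSet (halfOpenCube I) :=
  MeasurableSet.univ_pi fun _ => measurableSet_Ico

theorem measurableSet_unitCube : MeasurableSet (unitCube d) :=
  MeasurableSet.univ_pi fun _ => measurableSet_Ico

variable [NeZero N]

theorem base_pos : (0 : ℝ) < N := Nat.cast_pos.2 (NeZero.pos N)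

theorem closure_halfOpenCube (I : Word N d n) : closure (halfOpenCube I) = cube I := by
  have h (l : Fin d) : corner I l ≠ corner I l + 1 / (N : ℝ) ^ n := by
    have := base_pos (N := N)
    have : 0 < 1 / (N : ℝ) ^ n := by positivity
    linarith
  simp only [halfOpenCube, closure_pi_set, closure_Ico (h _), cube, Set.pi_univ_Icc]

/-- Dividing `⌊N^(n+1) x⌋` by `N` leaves quotient `⌊N^n x⌋` and, as remainder, the next digit. -/
theorem corner_word {x : Fin d → ℝ} (hx : x ∈ unitCube d) (n : ℕ) (l : Fin d) :
    (N : ℝ) ^ n * corner (word N n x) l = ⌊(N : ℝ) ^ n * x l⌋₊ := by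
  have hN := base_pos (N := N)
  induction n with
  | zero => simp [corner, Nat.floor_eq_zero.2 (hx l trivial).2]
  | succ n ih =>
    have h1 : ⌊(N : ℝ) ^ n * x l⌋₊ = ⌊(N : ℝ) ^ (n + 1) * x l⌋₊ / N := by
      rw [← Nat.floor_div_natCast, pow_succ]
      congr 1
      field_simp
    have h2 : ((word N (n + 1) x (Fin.last n) l : ℕ)) = ⌊(N : ℝ) ^ (n + 1) * x l⌋₊ % N := by
      simp [word, Fin.ofNat]
    rw [corner_succ, h2, mul_add, mul_div_cancel₀ _ (by positivity), pow_succ', mul_assoc]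
    change N * ((N : ℝ) ^ n * corner (word N n x) l) + _ = _
    rw [ih, h1, ← pow_succ']
    exact_mod_cast Nat.div_add_mod _ N

theorem mem_halfOpenCube_word {x : Fin d → ℝ} (hx : x ∈ unitCube d) (n : ℕ) :
    x ∈ halfOpenCube (word N n x) := by
  have hN := base_pos (N := N)
  intro l _
  have hp : (0 : ℝ) < (N : ℝ) ^ n := by positivity
  have h := corner_word (N := N) hx n l
  have h0 : 0 ≤ (N : ℝ) ^ n * x l := mul_nonneg hp.le (hx l trivial).1
  constructor
  · refine le_of_mul_le_mul_left ?_ hp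
    rw [h]
    exact Nat.floor_le h0
  · refine lt_of_mul_lt_mul_left ?_ hp.le
    rw [mul_add, h, mul_one_div_cancel hp.ne']
    exact Nat.lt_floor_add_one _

theorem halfOpenCube_subset_take_succ (I : Word N d (n + 1)) :
    halfOpenCube I ⊆ halfOpenCube (Word.take n.le_succ I) := by
  have hN := base_pos (N := N)
  refine Set.pi_mono fun l _ => Set.Ico_subset_Ico ?_ ?_
  · rw [corner_succ]
    have : 0 ≤ ((I (Fin.last n) l : ℕ) : ℝ) / (N : ℝ) ^ (n + 1) := by positivity
    linarith
  · rw [corner_succ, add_assoc, ← add_div]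
    refine add_le_add_right ?_ _
    rw [div_le_div_iff₀ (by positivity) (by positivity), pow_succ', one_mul]
    gcongr
    exact_mod_cast (I (Fin.last n) l).isLt

theorem mem_unitCube_and_word_eq {x : Fin d → ℝ} {I : Word N d n} (hx : x ∈ halfOpenCube I) :
    x ∈ unitCube d ∧ word N n x = I := by
  have hN := base_pos (N := N)
  induction n with
  | zero =>
    refine ⟨fun l _ => ?_, funext fun j => j.elim0⟩
    simpa [corner] using hx l trivial
  | succ n ih =>
    obtain ⟨hu, hw⟩ := ih (halfOpenCube_subset_take_succ I hx)
    refine ⟨hu, ?_⟩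
    have hp : (0 : ℝ) < (N : ℝ) ^ (n + 1) := by positivity
    have hlast (l : Fin d) : word N (n + 1) x (Fin.last n) l = I (Fin.last n) l := by
      have h1 := corner_word (N := N) hu n l
      rw [hw] at h1
      have h2 : (N : ℝ) ^ (n + 1) * corner I l
          = (N * ⌊(N : ℝ) ^ n * x l⌋₊ + (I (Fin.last n) l : ℕ) : ℕ) := by
        rw [corner_succ, mul_add, mul_div_cancel₀ _ hp.ne', pow_succ', mul_assoc, h1]
        push_cast
        ring
      have h3 : ⌊(N : ℝ) ^ (n + 1) * x l⌋₊
          = N * ⌊(N : ℝ) ^ n * x l⌋₊ + (I (Fin.last n) l : ℕ) := by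
        have hxl := hx l trivial
        rw [Nat.floor_eq_iff (mul_nonneg hp.le (hu l trivial).1), ← h2]
        refine ⟨mul_le_mul_of_nonneg_left hxl.1 hp.le, ?_⟩
        have := mul_lt_mul_of_pos_left hxl.2 hp
        rwa [mul_add, mul_one_div_cancel hp.ne'] at this
      apply Fin.ext
      simp only [word, Fin.ofNat, Fin.val_last, h3, Nat.mul_add_mod]
      exact Nat.mod_eq_of_lt (I (Fin.last n) l).isLt
    funext j l
    induction j using Fin.lastCases with
    | last => exact hlast l
    | cast j => exact congrFun (congrFun hw j) l

theorem mem_halfOpenCube_iff {x : Fin d → ℝ} {I : Word N d n} :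
    x ∈ halfOpenCube I ↔ x ∈ unitCube d ∧ word N n x = I :=
  ⟨mem_unitCube_and_word_eq, fun h => h.2 ▸ mem_halfOpenCube_word h.1 n⟩

theorem halfOpenCube_subset_take (h : m ≤ n) (I : Word N d n) :
    halfOpenCube I ⊆ halfOpenCube (Word.take h I) := by
  intro x hx
  rw [mem_halfOpenCube_iff] at hx ⊢
  exact ⟨hx.1, hx.2 ▸ rfl⟩

theorem cube_subset_cube_take (h : m ≤ n) (I : Word N d n) : cube I ⊆ cube (Word.take h I) := by
  rw [← closure_halfOpenCube, ← closure_halfOpenCube]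
  exact closure_mono (halfOpenCube_subset_take h I)

/-- A cube that meets the interior of a larger one descends from it. -/
theorem take_eq_of_mem_cube_of_mem_openCube (h : m ≤ n) {I : Word N d m} {J : Word N d n}
    {z : Fin d → ℝ} (hJ : z ∈ cube J) (hI : z ∈ openCube I) : Word.take h J = I := by
  rw [← closure_halfOpenCube, mem_closure_iff] at hJ
  obtain ⟨y, hyI, hyJ⟩ := hJ _ (isOpen_openCube I) hI
  rw [← (mem_halfOpenCube_iff.1 hyJ).2, ← (mem_halfOpenCube_iff.1
    (openCube_subset_halfOpenCube I hyI)).2]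
  rfl

theorem cube_subset_Icc (I : Word N d n) : cube I ⊆ Set.Icc 0 1 := by
  refine (cube_subset_cube_take n.zero_le I).trans ?_
  apply Set.Icc_subset_Icc <;> intro l <;> simp [corner]

theorem measurable_word (n : ℕ) : Measurable (word N n : (Fin d → ℝ) → Word N d n) := by
  refine measurable_pi_iff.2 fun j => measurable_pi_iff.2 fun l => ?_
  exact (Measurable.of_discrete (f := Fin.ofNat N)).comp
    (Nat.measurable_floor.comp (measurable_const.mul (measurable_pi_apply l)))

theorem measurableSet_generic : MeasurableSet (generic N d) := by
  have : generic N d = unitCube d ∩ ⋂ n, ⋃ I : Word N d n, word N n ⁻¹' {I} ∩ openCube I := by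
    ext x
    simp [generic]
  rw [this]
  exact measurableSet_unitCube.inter <| .iInter fun n => .iUnion fun I =>
    (measurable_word n (measurableSet_singleton I)).inter (isOpen_openCube I).measurableSet

/-- The exceptional points lie on countably many coordinate hyperplanes. -/
theorem ae_mem_generic : ∀ᵐ x : Fin d → ℝ, x ∈ Set.Icc (0 : Fin d → ℝ) 1 → x ∈ generic N d := by
  have hyp (l : Fin d) (c : ℝ) : ∀ᵐ x : Fin d → ℝ, x l ≠ c :=
    measure_eq_zero_iff_ae_notMem.1 (Measure.pi_hyperplane (fun _ : Fin d => (volume : Measure ℝ)) l c)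
  have h1 : ∀ᵐ x : Fin d → ℝ, ∀ l, x l ≠ 1 := ae_all_iff.2 fun l => hyp l 1
  have h2 : ∀ᵐ x : Fin d → ℝ, ∀ (n : ℕ) (I : Word N d n) (l : Fin d), x l ≠ corner I l :=
    ae_all_iff.2 fun n => ae_all_iff.2 fun I => ae_all_iff.2 fun l => hyp l _
  filter_upwards [h1, h2] with x hx1 hx2 hx
  have hu : x ∈ unitCube d := fun l _ => ⟨hx.1 l, lt_of_le_of_ne (hx.2 l) (hx1 l)⟩
  refine ⟨hu, fun n l _ => ?_⟩
  have := mem_halfOpenCube_word (N := N) hu n l trivial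
  exact ⟨lt_of_le_of_ne this.1 (hx2 n _ l).symm, this.2⟩

end Geometry

/-! ### Isolation of a point: locality and translation invariance -/

section Isolation

variable {N d m n : ℕ} [NeZero N]

/-- `x` can be isolated in the limit set: at arbitrarily small scales, the retained cubes of some
level split into two families without contact, one of which contains `x` and is small. -/
def Isolated (ω : Config N d) (x : Fin d → ℝ) : Prop :=
  ∀ k : ℕ, ∃ n, ∃ W : Finset (Word N d n), word N n x ∈ W ∧
    (∀ I ∈ W, ∀ J ∈ W, ∀ a ∈ cube I, ∀ b ∈ cube J, dist a b ≤ 1 / ((k : ℝ) + 1)) ∧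
    ∀ I ∈ W, ∀ J ∉ W, Retained ω I → Retained ω J → Disjoint (cube I) (cube J)

/-- The permutation of the words that exchanges, for every `j`, the digits `I j` and `J j` in
position `j`. -/
def digitSwap (I J : Word N d m) (n : ℕ) : Equiv.Perm (Word N d n) :=
  Equiv.piCongrRight fun j =>
    if h : (j : ℕ) < m then Equiv.swap (I ⟨j, h⟩) (J ⟨j, h⟩) else Equiv.refl _

omit [NeZero N] in
theorem digitSwap_apply (I J : Word N d m) (K : Word N d n) (j : Fin n) :
    digitSwap I J n K j =
      if h : (j : ℕ) < m then Equiv.swap (I ⟨j, h⟩) (J ⟨j, h⟩) (K j) else K j := by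
  simp only [digitSwap, Equiv.piCongrRight_apply, Pi.map_apply]
  split_ifs <;> rfl

omit [NeZero N] in
theorem digitSwap_comm (I J : Word N d m) : digitSwap I J n = digitSwap J I n := by
  ext1 K
  funext j
  simp only [digitSwap_apply, Equiv.swap_comm]

omit [NeZero N] in
@[simp] theorem digitSwap_digitSwap (I J : Word N d m) (K : Word N d n) :
    digitSwap I J n (digitSwap I J n K) = K := by
  funext j
  simp only [digitSwap_apply]
  split_ifs <;> simp

omit [NeZero N] in
theorem take_digitSwap (I J : Word N d m) {k : ℕ} (h : k ≤ n) (K : Word N d n) :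
    Word.take h (digitSwap I J n K) = digitSwap I J k (Word.take h K) := by
  funext j
  simp [digitSwap_apply]

omit [NeZero N] in
@[simp] theorem digitSwap_self (I J : Word N d m) : digitSwap I J m I = J := by
  funext j
  simp [digitSwap_apply]

omit [NeZero N] in
-- On a descendant of `I` the swap writes `J` over the first `m` digits and keeps the others, so it
-- translates the cube.
theorem corner_digitSwap {I J : Word N d m} (h : m ≤ n) {K : Word N d n} (hK : Word.take h K = I)
    (l : Fin d) : corner (digitSwap I J n K) l = corner K l + (corner J l - corner I l) := by
  obtain ⟨k, rfl⟩ := Nat.exists_eq_add_of_le h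
  have h1 (j : Fin m) : digitSwap I J (m + k) K (Fin.castAdd k j) = J j := by
    have : K (Fin.castAdd k j) = I j := congrFun hK j
    simp [digitSwap_apply, this]
  have h2 (j : Fin k) : digitSwap I J (m + k) K (Fin.natAdd m j) = K (Fin.natAdd m j) := by
    simp [digitSwap_apply]
  have h3 (j : Fin m) : K (Fin.castAdd k j) = I j := congrFun hK j
  simp only [corner, Fin.sum_univ_add, h1, h2, h3, Fin.val_castAdd]
  ring

omit [NeZero N] in
theorem mem_cube_digitSwap_iff {I J : Word N d m} (h : m ≤ n) {K : Word N d n}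
    (hK : Word.take h K = I) (z : Fin d → ℝ) :
    z + (corner J - corner I) ∈ cube (digitSwap I J n K) ↔ z ∈ cube K := by
  simp only [cube, Set.mem_Icc, Pi.le_def, corner_digitSwap h hK, Pi.add_apply, Pi.sub_apply,
    add_le_add_iff_right, add_right_comm _ _ (1 / (N : ℝ) ^ n)]

omit [NeZero N] in
theorem mem_openCube_iff_sub (I J : Word N d m) (z : Fin d → ℝ) :
    z + (corner J - corner I) ∈ openCube J ↔ z ∈ openCube I := by
  simp only [openCube, Set.mem_univ_pi, Set.mem_Ioo, Pi.add_apply, Pi.sub_apply]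
  refine forall_congr' fun l => and_congr ?_ ?_ <;> constructor <;> intro h <;> linarith

theorem word_eq_digitSwap {x y : Fin d → ℝ} (hx : x ∈ unitCube d)
    (hxy : y = x + (corner (word N m y) - corner (word N m x))) (n : ℕ) :
    word N n y = digitSwap (word N m x) (word N m y) n (word N n x) := by
  rcases le_total m n with h | h
  · have hmem := mem_halfOpenCube_word (N := N) hx n
    refine (mem_halfOpenCube_iff.1 (?_ : y ∈ halfOpenCube _)).2
    intro l _
    have hl := hmem l trivial
    beta_reduce
    rw [corner_digitSwap (I := word N m x) h rfl]
    have := congrFun hxy l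
    simp only [Pi.add_apply, Pi.sub_apply] at this
    constructor <;> linarith [hl.1, hl.2]
  · have : word N n y = Word.take h (digitSwap (word N m x) (word N m y) m (word N m x)) := by
      rw [digitSwap_self]
      rfl
    rw [this, take_digitSwap]
    rfl

/-- Whether a point can be isolated depends only on the retained cubes below one of the cubes that
contain it, and this dependence is invariant under translations between cubes of one level. -/
theorem Isolated.of_retained_iff [NeZero d] {x y : Fin d → ℝ} (hx : x ∈ generic N d)
    (hxy : y = x + (corner (word N m y) - corner (word N m x))) {ω ω' : Config N d}
    (hω : ∀ n, ∀ h : m ≤ n, ∀ K : Word N d n, Word.take h K = word N m x →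
      (Retained ω K ↔ Retained ω' (digitSwap (word N m x) (word N m y) n K)))
    (hI : Isolated ω x) : Isolated ω' y := by
  intro k
  have hN := base_pos (N := N)
  obtain ⟨r, hr, hball⟩ := Metric.isOpen_iff.1 (isOpen_openCube (word N m x)) x (hx.2 m)
  obtain ⟨k₀, hk₀⟩ := exists_nat_one_div_lt hr
  have hk' : 1 / (((max k k₀ : ℕ) : ℝ) + 1) ≤ 1 / ((k₀ : ℝ) + 1) := by
    gcongr
    exact le_max_right _ _
  have hk'' : 1 / (((max k k₀ : ℕ) : ℝ) + 1) ≤ 1 / ((k : ℝ) + 1) := by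
    gcongr
    exact le_max_left _ _
  -- The index `k` gives the required scale; `k₀` keeps the cluster inside the open level-`m` cube
  -- of `x`.
  obtain ⟨n, W, hxW, hdiam, hsep⟩ := hI (max k k₀)
  have hxc : x ∈ cube (word N n x) := halfOpenCube_subset_cube _ (mem_halfOpenCube_word hx.1 n)
  have hsub (I) (hI : I ∈ W) : cube I ⊆ openCube (word N m x) := fun a ha =>
    hball (Metric.mem_ball.2 ((hdiam I hI _ hxW a ha x hxc).trans_lt
      (hk'.trans_lt hk₀)))
  -- A cube of level below `m` that contains `x` also contains a corner of the level-`m` cube, which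
  -- is not in its interior.
  have hmn : m ≤ n := by
    by_contra! hlt
    have hc : corner (word N m x) ∈ cube (word N m x) :=
      ⟨le_rfl, fun l => le_add_of_nonneg_right (by positivity)⟩
    exact lt_irrefl _ (hsub _ hxW (cube_subset_cube_take hlt.le (word N m x) hc) 0 trivial).1
  have htake (I) (hI : I ∈ W) : Word.take hmn I = word N m x :=
    have hc : corner I ∈ cube I := ⟨le_rfl, fun l => le_add_of_nonneg_right (by positivity)⟩
    take_eq_of_mem_cube_of_mem_openCube hmn hc (hsub I hI hc)
  set σ := digitSwap (word N m x) (word N m y)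
  set v := corner (word N m y) - corner (word N m x)
  have hcube {I : Word N d n} (hI : Word.take hmn I = word N m x) {a : Fin d → ℝ}
      (ha : a ∈ cube (σ n I)) : a - v ∈ cube I := by
    rwa [← mem_cube_digitSwap_iff (J := word N m y) hmn hI, sub_add_cancel]
  refine ⟨n, W.map (σ n).toEmbedding, ?_, ?_, ?_⟩
  · rw [word_eq_digitSwap hx.1 hxy n]
    exact Finset.mem_map_of_mem _ hxW
  · simp only [Finset.forall_mem_map, Equiv.coe_toEmbedding]
    intro I hI J hJ a ha b hb
    rw [← dist_sub_right a b v]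
    exact (hdiam I hI J hJ _ (hcube (htake I hI) ha) _ (hcube (htake J hJ) hb)).trans hk''
  · simp only [Finset.forall_mem_map, Equiv.coe_toEmbedding]
    intro I hI J hJ hIr hJr
    obtain ⟨J, rfl⟩ := (σ n).surjective J
    rw [Set.disjoint_left]
    intro z hzI hzJ
    have hz := hsub I hI (hcube (htake I hI) hzI)
    rw [← mem_openCube_iff_sub _ (word N m y), sub_add_cancel] at hz
    -- Any cube that touches the translated cluster meets the open level-`m` cube of `y`, hence
    -- descends from it; so `hω` covers its retention too.
    have hJt : Word.take hmn J = word N m x := by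
      have := take_eq_of_mem_cube_of_mem_openCube hmn hzJ hz
      rw [take_digitSwap, digitSwap_comm] at this
      rw [← digitSwap_digitSwap (word N m y) (word N m x) (Word.take hmn J), this, digitSwap_self]
    exact Set.disjoint_left.1 (hsep I hI J (fun h => hJ (Finset.mem_map_of_mem _ h))
      ((hω n hmn I (htake I hI)).2 hIr) ((hω n hmn J hJt).2 hJr))
      (hcube (htake I hI) hzI) (hcube hJt hzJ)

/-- The configuration in which all cubes that contain the generic point `x` are made open. -/
noncomputable def openAlong (x : Fin d → ℝ) (ω : Config N d) : Config N d :=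
  fun i => if i.2 = word N (i.1 + 1) x then true else ω i

theorem openAlong_eq_self {x : Fin d → ℝ} {ω : Config N d}
    (h : ∀ n, Retained ω (word N n x)) : openAlong x ω = ω := by
  funext ⟨n, I⟩
  unfold openAlong
  split_ifs with hI
  · obtain rfl : I = word N (n + 1) x := hI
    exact (h (n + 1) n le_rfl).symm
  · rfl

/-- Isolation of `x` does not depend on the retention variables of low level. -/
theorem Isolated.openAlong_congr [NeZero d] {x : Fin d → ℝ} (hx : x ∈ generic N d)
    {ω ω' : Config N d} (h : ∀ i : CubeIndex N d, m ≤ i.1 → ω i = ω' i)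
    (hI : Isolated (openAlong x ω) x) : Isolated (openAlong x ω') x := by
  refine hI.of_retained_iff (m := m) hx (by simp) fun n hmn K hK => ?_
  have hσ : digitSwap (word N m x) (word N m x) n K = K := by
    funext j
    simp [digitSwap_apply]
  rw [hσ]
  refine forall_congr' fun k => forall_congr' fun hk => ?_
  refine Bool.eq_iff_iff.1 ?_
  unfold openAlong
  split_ifs with hif
  · rfl
  -- An ancestor of `K` of level at most `m` contains `x` and was forced open, so only levels above
  -- `m` remain.
  · refine h _ ?_
    by_contra! hlt
    apply hif
    funext j
    exact congrFun hK ⟨j, j.isLt.trans_le hlt⟩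

/-- The permutation of the cubes induced by `digitSwap`. -/
def cubeSwap (I J : Word N d m) : Equiv.Perm (CubeIndex N d) :=
  Equiv.sigmaCongrRight fun n => digitSwap I J (n + 1)

omit [NeZero N] in
theorem retained_comp_cubeSwap (I J : Word N d m) (ω : Config N d) (K : Word N d n) :
    Retained (ω ∘ cubeSwap I J) K ↔ Retained ω (digitSwap I J n K) := by
  refine forall_congr' fun k => forall_congr' fun hk => ?_
  change ω ⟨k, digitSwap I J (k + 1) (Word.take hk K)⟩ = true ↔ _
  rw [← take_digitSwap]

theorem openAlong_comp_cubeSwap {x y : Fin d → ℝ} (hx : x ∈ unitCube d)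
    (hxy : y = x + (corner (word N m y) - corner (word N m x))) (ω : Config N d) :
    openAlong x (ω ∘ cubeSwap (word N m x) (word N m y))
      = openAlong y ω ∘ cubeSwap (word N m x) (word N m y) := by
  funext ⟨n, I⟩
  have h : I = word N (n + 1) x ↔
      digitSwap (word N m x) (word N m y) (n + 1) I = word N (n + 1) y := by
    rw [word_eq_digitSwap hx hxy (n + 1), Equiv.apply_eq_iff_eq]
  exact if_congr h rfl rfl

/-- Isolation is invariant under translation of the point and of the configuration. -/
theorem isolated_openAlong_comp_cubeSwap_iff [NeZero d] {x y : Fin d → ℝ} (hx : x ∈ generic N d)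
    (hy : y ∈ generic N d) (hxy : y = x + (corner (word N m y) - corner (word N m x)))
    (ω : Config N d) :
    Isolated (openAlong x (ω ∘ cubeSwap (word N m x) (word N m y))) x ↔
      Isolated (openAlong y ω) y := by
  rw [openAlong_comp_cubeSwap hx.1 hxy]
  constructor <;> intro h
  · exact h.of_retained_iff hx hxy fun n hmn K _ => retained_comp_cubeSwap _ _ _ _
  · refine h.of_retained_iff (m := m) hy ?_ fun n hmn K _ => ?_
    · rw [← neg_sub, ← sub_eq_add_neg]
      exact eq_sub_of_add_eq hxy.symm
    · rw [retained_comp_cubeSwap, digitSwap_comm, digitSwap_digitSwap]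

end Isolation

/-! ### Isolation and trivial connected components -/

section Topology

variable {N d m n : ℕ} [NeZero N] {ω : Config N d}

omit [NeZero N] in
theorem isCompact_cube (I : Word N d n) : IsCompact (cube I) := isCompact_Icc

omit [NeZero N] in
theorem isCompact_levelSet (ω : Config N d) (n : ℕ) : IsCompact (levelSet ω n) :=
  isCompact_iUnion fun I => isCompact_iUnion fun _ => isCompact_cube I

omit [NeZero N] in
theorem Retained.take (h : m ≤ n) {I : Word N d n} (hI : Retained ω I) :
    Retained ω (Word.take h I) :=
  fun k hk => hI k (hk.trans h)

theorem levelSet_antitone (ω : Config N d) : Antitone (levelSet ω) := by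
  intro m n h x hx
  simp only [levelSet, Set.mem_iUnion] at hx ⊢
  obtain ⟨I, hI, hxI⟩ := hx
  exact ⟨Word.take h I, hI.take h, cube_subset_cube_take h I hxI⟩

theorem limitSet_eq_iInter (ω : Config N d) : limitSet ω = ⋂ n, levelSet ω n := by
  refine Set.Subset.antisymm ?_ (Set.subset_iInter₂ fun n _ => Set.iInter_subset _ n)
  refine Set.subset_iInter fun n => ?_
  exact (Set.iInter₂_subset (n + 1) (Nat.le_add_left 1 n)).trans (levelSet_antitone ω n.le_succ)

omit [NeZero N] in
theorem isCompact_limitSet (ω : Config N d) : IsCompact (limitSet ω) := by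
  refine (isCompact_levelSet ω 1).of_isClosed_subset ?_ (Set.iInter₂_subset 1 le_rfl)
  exact isClosed_iInter fun n => isClosed_iInter fun _ => (isCompact_levelSet ω n).isClosed

theorem limitSet_subset_Icc (ω : Config N d) : limitSet ω ⊆ Set.Icc 0 1 :=
  (Set.iInter₂_subset 1 le_rfl).trans (Set.iUnion₂_subset fun I _ => cube_subset_Icc I)

theorem mem_limitSet_iff {x : Fin d → ℝ} (hx : x ∈ generic N d) :
    x ∈ limitSet ω ↔ ∀ n, Retained ω (word N n x) := by
  simp only [limitSet_eq_iInter, Set.mem_iInter, levelSet, Set.mem_iUnion, exists_prop]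
  refine forall_congr' fun n => ⟨fun ⟨I, hI, hxI⟩ => ?_, fun h => ⟨_, h,
    halfOpenCube_subset_cube _ (mem_halfOpenCube_word hx.1 n)⟩⟩
  rwa [← take_eq_of_mem_cube_of_mem_openCube le_rfl hxI (hx.2 n)]

omit [NeZero N] in
theorem dist_le_of_mem_cube {I : Word N d n} {a b : Fin d → ℝ} (ha : a ∈ cube I)
    (hb : b ∈ cube I) : dist a b ≤ 1 / (N : ℝ) ^ n := by
  refine (dist_pi_le_iff (by positivity)).2 fun l => ?_
  refine (Real.dist_le_of_mem_Icc ⟨ha.1 l, ha.2 l⟩ ⟨hb.1 l, hb.2 l⟩).trans ?_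
  simp

/-- The two families of retained cubes form disjoint closed sets that cover the limit set, so the
component of `x` stays in the small one. -/
theorem connectedComponentIn_eq_singleton {x : Fin d → ℝ} (hx : x ∈ generic N d)
    (hxD : x ∈ limitSet ω) (h : Isolated ω x) : connectedComponentIn (limitSet ω) x = {x} := by
  have hpre : IsPreconnected (connectedComponentIn (limitSet ω) x) :=
    isPreconnected_connectedComponentIn
  have hxC := mem_connectedComponentIn hxD
  refine Set.Subset.antisymm (fun y hy => ?_) (Set.singleton_subset_iff.2 hxC)
  refine Set.mem_singleton_iff.2 (dist_le_zero.1 (le_of_forall_pos_le_add fun ε hε => ?_))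
  obtain ⟨k, hk⟩ := exists_nat_one_div_lt hε
  obtain ⟨n, W, hxW, hdiam, hsep⟩ := h k
  have hxc : x ∈ cube (word N n x) := halfOpenCube_subset_cube _ (mem_halfOpenCube_word hx.1 n)
  have hclosed (P : Word N d n → Prop) : IsClosed (⋃ (I : Word N d n) (_ : P I), cube I) :=
    (isCompact_iUnion fun I => isCompact_iUnion fun _ => isCompact_cube I).isClosed
  have hdisj : Disjoint (⋃ (I : Word N d n) (_ : I ∈ W ∧ Retained ω I), cube I)
      (⋃ (I : Word N d n) (_ : I ∉ W ∧ Retained ω I), cube I) := by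
    simp only [Set.disjoint_iUnion_left, Set.disjoint_iUnion_right]
    exact fun I hI J hJ => hsep J hJ.1 I hI.1 hJ.2 hI.2
  have hcover : connectedComponentIn (limitSet ω) x ⊆
      (⋃ (I : Word N d n) (_ : I ∈ W ∧ Retained ω I), cube I) ∪
      (⋃ (I : Word N d n) (_ : I ∉ W ∧ Retained ω I), cube I) := by
    intro z hz
    have hzD := connectedComponentIn_subset _ _ hz
    rw [limitSet_eq_iInter] at hzD
    obtain ⟨I, hI, hzI⟩ := Set.mem_iUnion₂.1 (Set.mem_iInter.1 hzD n)
    by_cases hIW : I ∈ W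
    · exact Or.inl (Set.mem_iUnion₂.2 ⟨I, ⟨hIW, hI⟩, hzI⟩)
    · exact Or.inr (Set.mem_iUnion₂.2 ⟨I, ⟨hIW, hI⟩, hzI⟩)
  have hxS : x ∈ ⋃ (I : Word N d n) (_ : I ∈ W ∧ Retained ω I), cube I :=
    Set.mem_iUnion₂.2 ⟨_, ⟨hxW, (mem_limitSet_iff hx).1 hxD n⟩, hxc⟩
  rcases isPreconnected_iff_subset_of_disjoint_closed.1 hpre _ _ (hclosed _) (hclosed _) hcover
    (by rw [hdisj.inter_eq, Set.inter_empty]) with hS | hT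
  · obtain ⟨I, hI, hyI⟩ := Set.mem_iUnion₂.1 (hS hy)
    rw [zero_add]
    exact (hdiam I hI.1 _ hxW y hyI x hxc).trans hk.le
  · exact absurd (hT hxC) (Set.disjoint_left.1 hdisj hxS)

/-- In a compact Hausdorff space, a trivial connected component has arbitrarily small clopen
neighbourhoods. -/
theorem exists_isClopen_subset {X : Type*} [TopologicalSpace X] [T2Space X] [CompactSpace X]
    {x : X} (hx : connectedComponent x = {x}) {U : Set X} (hU : U ∈ nhds x) :
    ∃ s, IsClopen s ∧ x ∈ s ∧ s ⊆ U := by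
  have : Nonempty {s : Set X // IsClopen s ∧ x ∈ s} := ⟨⟨Set.univ, isClopen_univ, trivial⟩⟩
  obtain ⟨⟨s, hs, hxs⟩, hsU⟩ := exists_subset_nhds_of_isCompact
    (V := fun s : {s : Set X // IsClopen s ∧ x ∈ s} => (s : Set X))
    (fun s t => ⟨⟨s ∩ t, s.2.1.inter t.2.1, s.2.2, t.2.2⟩, Set.inter_subset_left,
      Set.inter_subset_right⟩) (fun s => s.2.1.isClosed.isCompact) (U := U) (by
      rw [← connectedComponent_eq_iInter_isClopen, hx]
      rintro y rfl
      exact hU)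
  exact ⟨s, hs, hxs, hsU⟩

/-- A small clopen piece `A` around `x` and the rest `B` of the limit set are compact and at
positive distance. By compactness, fine level sets lie close to `A ∪ B`, so their cubes split
accordingly. -/
theorem isolated_of_connectedComponentIn_eq (hN : 2 ≤ N) {x : Fin d → ℝ} (hx : x ∈ generic N d)
    (hxD : x ∈ limitSet ω) (h : connectedComponentIn (limitSet ω) x = {x}) : Isolated ω x := by
  classical
  intro k
  -- Cluster points are within `ε` of `A`, which is within `ε` of `x`; two of them are at most `4 *
  -- ε` apart.
  set ε : ℝ := 1 / ((k : ℝ) + 1) / 4 with hε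
  have hε0 : 0 < ε := by positivity
  have := isCompact_iff_compactSpace.1 (isCompact_limitSet ω)
  have hcomp : connectedComponent (⟨x, hxD⟩ : limitSet ω) = {⟨x, hxD⟩} := by
    rw [connectedComponentIn_eq_image hxD] at h
    refine Subtype.val_injective.image_injective ?_
    rw [h, Set.image_singleton]
  obtain ⟨s, hs, hxs, hsU⟩ := exists_isClopen_subset hcomp (Metric.ball_mem_nhds _ hε0)
  have hA : IsCompact (Subtype.val '' s) := hs.isClosed.isCompact.image continuous_subtype_val
  have hB : IsCompact (Subtype.val '' sᶜ) :=
    hs.compl.isClosed.isCompact.image continuous_subtype_val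
  obtain ⟨δ, hδ, hdisj⟩ := Disjoint.exists_thickenings
    ((Set.disjoint_image_iff Subtype.val_injective).2 disjoint_compl_right) hA hB.isClosed
  set A := Subtype.val '' s
  set B := Subtype.val '' sᶜ
  -- A cube of side below `ρ` that meets the `ρ`-thickening of `A` stays within `2 * ρ` of `A`,
  -- hence within both `δ` and `ε`.
  set ρ := min δ ε / 2 with hρ
  have hρ0 : 0 < ρ := by positivity
  have hρδ : ρ + ρ ≤ δ := by rw [hρ, add_halves]; exact min_le_left _ _
  have hρε : ρ + ρ ≤ ε := by rw [hρ, add_halves]; exact min_le_right _ _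
  obtain ⟨n₀, hn₀⟩ := exists_subset_nhds_of_isCompact
    (levelSet_antitone ω).directed_ge (isCompact_levelSet ω)
    (U := Metric.thickening ρ A ∪ Metric.thickening ρ B) (by
      rw [← limitSet_eq_iInter]
      intro y hy
      refine (Metric.isOpen_thickening.union Metric.isOpen_thickening).mem_nhds ?_
      by_cases hys : (⟨y, hy⟩ : limitSet ω) ∈ s
      · exact Or.inl (Metric.self_subset_thickening hρ0 _ ⟨_, hys, rfl⟩)
      · exact Or.inr (Metric.self_subset_thickening hρ0 _ ⟨_, hys, rfl⟩))
  obtain ⟨n₁, hn₁⟩ := exists_pow_lt_of_lt_one hρ0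
    (show (1 / (N : ℝ)) < 1 by
      rw [div_lt_one (by positivity)]
      exact_mod_cast hN)
  obtain ⟨n, hnn₀, hnn₁⟩ : ∃ n, n₀ ≤ n ∧ n₁ ≤ n := ⟨max n₀ n₁, le_max_left _ _, le_max_right _ _⟩
  have hlevel := (levelSet_antitone ω hnn₀).trans hn₀
  have hside : 1 / (N : ℝ) ^ n < ρ := by
    refine lt_of_le_of_lt ?_ hn₁
    rw [one_div_pow]
    have : (1 : ℝ) ≤ N := by exact_mod_cast (by omega : 1 ≤ N)
    gcongr
  have hthick {I : Word N d n} (hI : (cube I ∩ Metric.thickening ρ A).Nonempty) :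
      cube I ⊆ Metric.thickening (ρ + ρ) A := by
    obtain ⟨b, hb, hbA⟩ := hI
    obtain ⟨z, hz, hbz⟩ := Metric.mem_thickening_iff.1 hbA
    intro a ha
    refine Metric.mem_thickening_iff.2 ⟨z, hz, ?_⟩
    linarith [dist_triangle a b z, dist_le_of_mem_cube ha hb]
  have hxc : x ∈ cube (word N n x) := halfOpenCube_subset_cube _ (mem_halfOpenCube_word hx.1 n)
  refine ⟨n, Finset.univ.filter fun I => (cube I ∩ Metric.thickening ρ A).Nonempty, ?_, ?_, ?_⟩
  · simp only [Finset.mem_filter_univ]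
    exact ⟨x, hxc, Metric.self_subset_thickening hρ0 _ ⟨_, hxs, rfl⟩⟩
  · simp only [Finset.mem_filter_univ]
    have key {I : Word N d n} (hI : (cube I ∩ Metric.thickening ρ A).Nonempty) {a : Fin d → ℝ}
        (ha : a ∈ cube I) : dist a x ≤ 2 * ε := by
      obtain ⟨_, ⟨z, hz, rfl⟩, haz⟩ := Metric.mem_thickening_iff.1 (hthick hI ha)
      have : dist (z : Fin d → ℝ) x < ε := hsU hz
      linarith [dist_triangle a z x]
    intro I hI J hJ a ha b hb
    have h4 : 1 / ((k : ℝ) + 1) = 4 * ε := by rw [hε]; ring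
    linarith [dist_triangle_right a b x, key hI ha, key hJ hb]
  · simp only [Finset.mem_filter_univ]
    intro I hI J hJ _ hJr
    refine hdisj.mono ((hthick hI).trans (Metric.thickening_mono hρδ _)) ?_
    refine Set.Subset.trans (fun a ha => ?_)
      (Metric.thickening_mono ((le_add_of_nonneg_left hρ0.le).trans hρδ) _)
    exact (hlevel (Set.mem_iUnion₂.2 ⟨J, hJr, ha⟩)).resolve_left fun h => hJ ⟨a, ha, h⟩

/-- The right-hand side makes sense, and has a probability, without conditioning on the null-prone
event that `x` is in the limit set. -/
theorem connectedComponentIn_eq_singleton_iff (hN : 2 ≤ N) {x : Fin d → ℝ}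
    (hx : x ∈ generic N d) (hxD : x ∈ limitSet ω) :
    connectedComponentIn (limitSet ω) x = {x} ↔ Isolated (openAlong x ω) x := by
  rw [openAlong_eq_self ((mem_limitSet_iff hx).1 hxD)]
  exact ⟨isolated_of_connectedComponentIn_eq hN hx hxD, connectedComponentIn_eq_singleton hx hxD⟩

end Topology

/-! ### Independence, Kolmogorov's law and symmetry of the law -/

section Laws

variable {N d m n : ℕ}

instance (p : ℕ → unitInterval) : IsProbabilityMeasure (law N d p) := by
  unfold law
  infer_instance

theorem iIndep_comap_eval (p : ℕ → unitInterval) :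
    iIndep (fun i : CubeIndex N d => MeasurableSpace.comap (fun ω : Config N d => ω i) ⊤)
      (law N d p) :=
  iIndepFun_infinitePi (P := fun I : CubeIndex N d => bernoulliMeasure true false (p (I.1 + 1)))
    (X := fun _ b => b) (fun _ => measurable_id)

theorem comap_eval_le (i : CubeIndex N d) :
    MeasurableSpace.comap (fun ω : Config N d => ω i) ⊤ ≤ MeasurableSpace.pi :=
  (measurable_pi_apply i).comap_le

/-- A measurable event that depends only on the variables with index in `T` is measurable for the
`σ`-algebra that they generate. -/
theorem measurableSet_iSup_comap_eval {T : Set (CubeIndex N d)} {B : Set (Config N d)}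
    (hB : MeasurableSet B) (hT : ∀ ω ω' : Config N d, (∀ i ∈ T, ω i = ω' i) → ω ∈ B → ω' ∈ B) :
    MeasurableSet[⨆ i ∈ T, MeasurableSpace.comap (fun ω : Config N d => ω i) ⊤] B := by
  classical
  -- `Φ` resets the variables outside `T` to a constant; it is measurable for the smaller
  -- `σ`-algebra and leaves membership in `B` unchanged.
  let Φ : Config N d → Config N d := fun ω i => if i ∈ T then ω i else true
  have hΦ : Measurable[⨆ i ∈ T, MeasurableSpace.comap (fun ω : Config N d => ω i) ⊤] Φ := by
    refine @measurable_pi_lambda _ _ _ (_) _ _ fun i => ?_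
    by_cases hi : i ∈ T
    · simp only [Φ, hi, if_true]
      refine Measurable.mono (comap_measurable _) ?_ le_rfl
      exact le_iSup₂ (f := fun i _ => MeasurableSpace.comap (fun ω : Config N d => ω i) ⊤) i hi
    · simp only [Φ, hi, if_false]
      exact @measurable_const _ _ _ (_) _
  have : B = Φ ⁻¹' B := by
    ext ω
    constructor
    · exact hT ω (Φ ω) fun i hi => by simp [Φ, hi]
    · exact hT (Φ ω) ω fun i hi => by simp [Φ, hi]
  rw [this]
  exact hΦ hB

theorem law_inter_eq_mul (p : ℕ → unitInterval) {S T : Set (CubeIndex N d)} (hST : Disjoint S T)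
    {A B : Set (Config N d)} (hA : MeasurableSet A) (hB : MeasurableSet B)
    (hS : ∀ ω ω' : Config N d, (∀ i ∈ S, ω i = ω' i) → ω ∈ A → ω' ∈ A)
    (hT : ∀ ω ω' : Config N d, (∀ i ∈ T, ω i = ω' i) → ω ∈ B → ω' ∈ B) :
    law N d p (A ∩ B) = law N d p A * law N d p B :=
  (Indep_iff _ _ _).1 (indep_iSup_of_disjoint comap_eval_le (iIndep_comap_eval p) hST) _ _
    (measurableSet_iSup_comap_eval hA hS) (measurableSet_iSup_comap_eval hB hT)

/-- Kolmogorov's zero-one law for percolation configurations. -/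
theorem law_eq_zero_or_one (p : ℕ → unitInterval) {B : Set (Config N d)} (hB : MeasurableSet B)
    (h : ∀ (m : ℕ) (ω ω' : Config N d), (∀ i, m ≤ i.1 → ω i = ω' i) → ω ∈ B → ω' ∈ B) :
    law N d p B = 0 ∨ law N d p B = 1 := by
  refine measure_zero_or_one_of_measurableSet_limsup (ι := CubeIndex N d)
    (s := fun i => MeasurableSpace.comap (fun ω : Config N d => ω i) ⊤)
    -- The tail is taken along levels tending to infinity; the negligible index sets are those of
    -- bounded level.
    (f := ⨅ m : ℕ, Filter.principal {i : CubeIndex N d | m ≤ i.1})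
    (p := fun T => ∃ m : ℕ, T ⊆ {i | i.1 < m}) (ns := fun m : ℕ => {i : CubeIndex N d | i.1 < m})
    comap_eval_le (iIndep_comap_eval p) ?_ ?_ (fun m => ⟨m, subset_rfl⟩)
    (fun i => ⟨i.1 + 1, Nat.lt_succ_self _⟩) ?_
  · rintro T ⟨m, hm⟩
    refine Filter.mem_iInf_of_mem m fun i hi hiT => ?_
    exact absurd (show i.1 < m from hm hiT) (not_lt.2 hi)
  · exact (monotone_nat_of_le_succ fun m (i : CubeIndex N d) (hi : i.1 < m) =>
      Nat.lt_succ_of_lt hi).directed_le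
  · have hdir : Directed (· ≥ ·) fun m : ℕ => {i : CubeIndex N d | m ≤ i.1} := by
      refine Antitone.directed_ge fun m n hmn i (hi : n ≤ i.1) => hmn.trans hi
    have hbasis := Filter.hasBasis_iInf_principal hdir
    rw [hbasis.limsup_eq_iInf_iSup]
    simp only [MeasurableSpace.measurableSet_iInf]
    exact fun m _ => measurableSet_iSup_comap_eval hB fun ω ω' hω => h m ω ω' hω

/-- The permutation preserves levels, and the retention probability depends on the level only. -/
theorem measurePreserving_comp_cubeSwap (p : ℕ → unitInterval) (I J : Word N d m) :
    MeasurePreserving (fun ω : Config N d => ω ∘ cubeSwap I J) (law N d p) (law N d p) := by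
  refine ⟨measurable_pi_lambda _ fun i => measurable_pi_apply _, ?_⟩
  have h := Measure.infinitePi_map_piCongrLeft
    (fun i : CubeIndex N d => bernoulliMeasure true false (p (i.1 + 1))) (cubeSwap I J).symm
  have he : (MeasurableEquiv.piCongrLeft (fun _ : CubeIndex N d => Bool) (cubeSwap I J).symm :
      Config N d → Config N d) = fun ω => ω ∘ cubeSwap I J := by
    funext ω i
    rw [MeasurableEquiv.coe_piCongrLeft]
    simp [Equiv.piCongrLeft, Equiv.piCongrLeft']
  rw [he] at h
  exact h

variable [NeZero N]

theorem measurableSet_retained_openAlong (I : Word N d n) :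
    MeasurableSet {z : (Fin d → ℝ) × Config N d | Retained (openAlong z.1 z.2) I} := by
  simp only [Retained, Set.ofPred_forall]
  refine .iInter fun k => .iInter fun hk => ?_
  have : {z : (Fin d → ℝ) × Config N d |
      openAlong z.1 z.2 ⟨k, fun j => I (Fin.castLE hk j)⟩ = true} =
      Prod.fst ⁻¹' (word N (k + 1) ⁻¹' {fun j => I (Fin.castLE hk j)}) ∪
      Prod.snd ⁻¹' ((fun ω => ω ⟨k, fun j => I (Fin.castLE hk j)⟩) ⁻¹' {true}) := by
    ext z
    by_cases h : (fun j => I (Fin.castLE hk j)) = word N (k + 1) z.1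
    · simp [openAlong, h]
    · simp [openAlong, h, Ne.symm h]
  rw [this]
  exact (measurable_fst (measurable_word _ (measurableSet_singleton _))).union
    (measurable_snd (measurable_pi_apply _ (measurableSet_singleton _)))

theorem measurableSet_isolated_openAlong :
    MeasurableSet {z : (Fin d → ℝ) × Config N d | Isolated (openAlong z.1 z.2) z.1} := by
  refine measurableSet_setOfPred.2 (Measurable.forall fun k => .exists fun n => .exists fun W =>
    .and ?_ (.and measurable_const (.forall fun I => .imp measurable_const (.forall fun J =>
      .imp measurable_const (.imp ?_ (.imp ?_ measurable_const))))))
  · exact measurableSet_setOfPred.1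
      (measurable_fst (measurable_word n (MeasurableSet.of_discrete (s := {I | I ∈ W}))))
  · exact measurableSet_setOfPred.1 (measurableSet_retained_openAlong I)
  · exact measurableSet_setOfPred.1 (measurableSet_retained_openAlong J)

/-- The probability that `x` can be isolated once all the cubes that contain it are made open. -/
noncomputable def isolationProb (p : ℕ → unitInterval) (x : Fin d → ℝ) : ENNReal :=
  law N d p {ω | Isolated (openAlong x ω) x}

theorem measurable_isolationProb (p : ℕ → unitInterval) :
    Measurable (isolationProb (N := N) (d := d) p) :=
  measurable_measure_prodMk_left measurableSet_isolated_openAlong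

theorem measurableSet_isolated_openAlong_right (x : Fin d → ℝ) :
    MeasurableSet {ω : Config N d | Isolated (openAlong x ω) x} :=
  measurable_prodMk_left measurableSet_isolated_openAlong

theorem isolationProb_eq_zero_or_one [NeZero d] (p : ℕ → unitInterval) {x : Fin d → ℝ}
    (hx : x ∈ generic N d) :
    isolationProb (N := N) p x = 0 ∨ isolationProb (N := N) p x = 1 :=
  law_eq_zero_or_one p (measurableSet_isolated_openAlong_right x)
    fun _ _ _ h => Isolated.openAlong_congr hx h

theorem isolationProb_eq [NeZero d] (p : ℕ → unitInterval) {x y : Fin d → ℝ}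
    (hx : x ∈ generic N d) (hy : y ∈ generic N d)
    (hxy : y = x + (corner (word N m y) - corner (word N m x))) :
    isolationProb (N := N) p x = isolationProb (N := N) p y := by
  unfold isolationProb
  rw [← (measurePreserving_comp_cubeSwap p (word N m x) (word N m y)).measure_preimage
    (measurableSet_isolated_openAlong_right x).nullMeasurableSet]
  congr 1
  ext ω
  exact isolated_openAlong_comp_cubeSwap_iff hx hy hxy ω

end Laws

/-! ### A zero-one law for the isolation probability -/

section ZeroOne

variable {N d m n : ℕ} [NeZero N]

omit [NeZero N] in
theorem volume_unitCube : volume (unitCube d) = 1 := by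
  simp [unitCube, volume_pi_pi]

omit [NeZero N] in
theorem volume_halfOpenCube (I : Word N d n) :
    volume (halfOpenCube I) = ENNReal.ofReal (1 / (N : ℝ) ^ n) ^ d := by
  simp [halfOpenCube, volume_pi_pi]

/-- The events that prescribe the digits of a point up to some level. -/
def digitEvents (N d : ℕ) [NeZero N] : Set (Set (Fin d → ℝ)) :=
  {s | s = ∅ ∨ ∃ n, ∃ I : Word N d n, word N n ⁻¹' {I} = s}

theorem measurableSet_preimage_word (I : Word N d n) :
    MeasurableSet (word N n ⁻¹' {I} : Set (Fin d → ℝ)) :=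
  measurable_word n (measurableSet_singleton I)

theorem generateFrom_digitEvents_le :
    MeasurableSpace.generateFrom (digitEvents N d) ≤ MeasurableSpace.pi := by
  refine MeasurableSpace.generateFrom_le ?_
  rintro s (rfl | ⟨n, I, rfl⟩)
  · exact .empty
  · exact measurableSet_preimage_word I

theorem isPiSystem_digitEvents : IsPiSystem (digitEvents N d) := by
  have key {m n : ℕ} (hmn : m ≤ n) (I : Word N d m) (J : Word N d n)
      (hne : (word N m ⁻¹' {I} ∩ word N n ⁻¹' {J} : Set (Fin d → ℝ)).Nonempty) :
      (word N m ⁻¹' {I} ∩ word N n ⁻¹' {J} : Set (Fin d → ℝ)) = word N n ⁻¹' {J} := by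
    obtain ⟨x, rfl, rfl⟩ := hne
    refine Set.inter_eq_right.2 fun y hy => ?_
    exact congrArg (Word.take hmn) hy
  rintro s (rfl | ⟨m, I, rfl⟩) t (rfl | ⟨n, J, rfl⟩) hne
  · simp at hne
  · simp at hne
  · simp at hne
  · rcases le_total m n with hmn | hmn
    · exact Or.inr ⟨n, J, (key hmn I J hne).symm⟩
    · rw [Set.inter_comm] at hne ⊢
      exact Or.inr ⟨m, I, (key hmn J I hne).symm⟩

/-- The point of the unit cube with the same digits as `x`. -/
noncomputable def ofDigits (N : ℕ) [NeZero N] (x : Fin d → ℝ) : Fin d → ℝ :=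
  fun l => Filter.limsup (fun n => corner (word N n x) l) Filter.atTop

/-- Digits do not separate points outside the unit cube from those inside, so digit events do not
generate the Borel sets. The preimage of a Borel set under `ofDigits` is generated by them, and it
agrees with that set on the unit cube. -/
theorem measurable_ofDigits :
    Measurable[MeasurableSpace.generateFrom (digitEvents N d), MeasurableSpace.pi]
      (ofDigits N : (Fin d → ℝ) → Fin d → ℝ) := by
  have hwm (n : ℕ) : Measurable[MeasurableSpace.generateFrom (digitEvents N d)]
      (word N n : (Fin d → ℝ) → Word N d n) :=
    @measurable_to_countable' _ _ _ _ (MeasurableSpace.generateFrom (digitEvents N d)) _ fun I =>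
      MeasurableSpace.measurableSet_generateFrom (Or.inr ⟨n, I, rfl⟩)
  refine @measurable_pi_lambda _ _ _ (MeasurableSpace.generateFrom (digitEvents N d)) _ _
    fun l => ?_
  refine Measurable.limsup (mδ := MeasurableSpace.generateFrom (digitEvents N d)) fun n => ?_
  exact (Measurable.of_discrete (f := fun I : Word N d n => corner I l)).comp (hwm n)

theorem ofDigits_eq_self (hN : 2 ≤ N) {x : Fin d → ℝ} (hx : x ∈ unitCube d) :
    ofDigits N x = x := by
  funext l
  refine Filter.Tendsto.limsup_eq ?_
  have h0 : Filter.Tendsto (fun n : ℕ => x l - 1 / (N : ℝ) ^ n) Filter.atTop (nhds (x l)) := by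
    have : Filter.Tendsto (fun n : ℕ => (1 / (N : ℝ)) ^ n) Filter.atTop (nhds 0) := by
      refine tendsto_pow_atTop_nhds_zero_of_lt_one (by positivity) ?_
      rw [div_lt_one base_pos]
      exact_mod_cast hN
    simpa [one_div_pow] using tendsto_const_nhds (x := x l).sub this
  refine tendsto_of_tendsto_of_tendsto_of_le_of_le h0 tendsto_const_nhds (fun n => ?_)
    fun n => ?_
  · have := (mem_halfOpenCube_word (N := N) hx n l trivial).2
    simp only
    linarith
  · exact (mem_halfOpenCube_word (N := N) hx n l trivial).1

/-- A measurable subset of the unit cube that occupies the same volume in all `N`-adic cubes of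
each level is null or conull. -/
theorem volume_eq_zero_or_one (hN : 2 ≤ N) {A : Set (Fin d → ℝ)} (hA : MeasurableSet A)
    (hAu : A ⊆ unitCube d)
    (h : ∀ (n : ℕ) (I J : Word N d n), volume (A ∩ halfOpenCube I) ≤ volume (A ∩ halfOpenCube J)) :
    volume A = 0 ∨ volume A = 1 := by
  have hpre (n : ℕ) (I : Word N d n) : word N n ⁻¹' {I} ∩ unitCube d = halfOpenCube I := by
    ext x
    simp [mem_halfOpenCube_iff, and_comm]
  have hfin : volume A ≠ ⊤ :=
    ne_top_of_le_ne_top ENNReal.one_ne_top (volume_unitCube (d := d) ▸ measure_mono hAu)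
  have hsum (B : Set (Fin d → ℝ)) (hBu : B ⊆ unitCube d)
      (hB : ∀ (n : ℕ) (I J : Word N d n),
        volume (B ∩ halfOpenCube I) = volume (B ∩ halfOpenCube J)) (n : ℕ) (I : Word N d n) :
      Fintype.card (Word N d n) * volume (B ∩ halfOpenCube I) = volume B := by
    have := sum_measure_preimage_singleton (μ := volume.restrict B) (f := word N n)
      (Finset.univ : Finset (Word N d n)) fun I _ => measurableSet_preimage_word I
    simp only [Finset.coe_univ, Set.preimage_univ, Measure.restrict_apply_univ] at this
    rw [← this, Finset.sum_congr rfl (g := fun _ => volume (B ∩ halfOpenCube I)), Finset.sum_const,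
      Finset.card_univ, nsmul_eq_mul]
    intro J _
    rw [Measure.restrict_apply (measurableSet_preimage_word J), hB n I J, ← hpre, Set.inter_comm,
      ← Set.inter_assoc, Set.inter_right_comm, Set.inter_eq_left.2 hBu]
  have hprod (n : ℕ) (I : Word N d n) :
      volume (A ∩ halfOpenCube I) = volume A * volume (halfOpenCube I) := by
    have h1 := hsum A hAu (fun n I J => le_antisymm (h n I J) (h n J I)) n I
    have hsub (n : ℕ) (I : Word N d n) : unitCube d ∩ halfOpenCube I = halfOpenCube I :=
      Set.inter_eq_right.2 fun x hx => (mem_halfOpenCube_iff.1 hx).1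
    have h2 := hsum (unitCube d) subset_rfl
      (fun n I J => by rw [hsub, hsub, volume_halfOpenCube, volume_halfOpenCube]) n I
    rw [hsub, volume_unitCube] at h2
    rw [← h1, mul_right_comm, h2, one_mul]
  have hgA : ofDigits N ⁻¹' A ∩ unitCube d = A := by
    ext x
    constructor
    · rintro ⟨hx, hu⟩
      rwa [Set.mem_preimage, ofDigits_eq_self hN hu] at hx
    · intro hx
      refine ⟨?_, hAu hx⟩
      rwa [Set.mem_preimage, ofDigits_eq_self hN (hAu hx)]
  have : IsFiniteMeasure ((volume.restrict (unitCube d)).restrict A) :=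
    ⟨by
      rw [Measure.restrict_apply_univ]
      exact (Measure.restrict_apply_le _ _).trans_lt hfin.lt_top⟩
  -- Both measures agree on digit events by `hprod`. Evaluated at `ofDigits N ⁻¹' A` they give
  -- `volume A = volume A * volume A`.
  have hext := ext_on_measurableSpace_of_generate_finite MeasurableSpace.pi
    (μ := (volume.restrict (unitCube d)).restrict A) (ν := volume A • volume.restrict (unitCube d))
    (digitEvents N d) ?_ generateFrom_digitEvents_le rfl isPiSystem_digitEvents ?_
    (measurable_ofDigits hA)
  · rw [Measure.restrict_apply (generateFrom_digitEvents_le _ (measurable_ofDigits hA)),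
      Measure.restrict_apply' measurableSet_unitCube,
      Set.inter_right_comm, hgA, Set.inter_self, Measure.smul_apply,
      Measure.restrict_apply' measurableSet_unitCube, hgA, smul_eq_mul] at hext
    rcases eq_or_ne (volume A) 0 with h0 | h0
    · exact Or.inl h0
    · exact Or.inr ((ENNReal.mul_eq_left h0 hfin).1 hext.symm)
  · rintro s (rfl | ⟨n, I, rfl⟩)
    · simp
    · rw [Measure.restrict_apply (measurableSet_preimage_word I),
        Measure.restrict_apply' measurableSet_unitCube, Measure.smul_apply,
        Measure.restrict_apply' measurableSet_unitCube, hpre, smul_eq_mul, ← hprod,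
        Set.inter_right_comm, hpre, Set.inter_comm]
  · simp [Measure.restrict_apply' measurableSet_unitCube, Set.inter_eq_left.2 hAu,
      volume_unitCube]

/-- The translation from `I` to `J` preserves volume, isolation probability and, up to a null set,
genericity. Equality follows by exchanging `I` and `J`. -/
theorem volume_isolationProb_inter_le [NeZero d] (p : ℕ → unitInterval) (I J : Word N d n) :
    volume ({x | x ∈ generic N d ∧ isolationProb (N := N) p x = 1} ∩ halfOpenCube I) ≤
      volume ({x | x ∈ generic N d ∧ isolationProb (N := N) p x = 1} ∩ halfOpenCube J) := by
  have hmp := measurePreserving_add_right (volume : Measure (Fin d → ℝ)) (corner J - corner I)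
  have hA : MeasurableSet
      ({x | x ∈ generic N d ∧ isolationProb (N := N) p x = 1} ∩ halfOpenCube J) :=
    (measurableSet_generic.inter
      (measurable_isolationProb p (measurableSet_singleton 1))).inter (measurableSet_halfOpenCube J)
  rw [← hmp.measure_preimage hA.nullMeasurableSet]
  refine measure_mono_ae ?_
  filter_upwards [hmp.quasiMeasurePreserving.ae (ae_mem_generic (N := N) (d := d))]
    with x hgen
  rintro ⟨⟨hx, hx1⟩, hxI⟩
  have hyJ : x + (corner J - corner I) ∈ halfOpenCube J := by
    intro l _
    have := hxI l trivial
    simp only [Pi.add_apply, Pi.sub_apply]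
    constructor <;> linarith [this.1, this.2]
  have hy := hgen (cube_subset_Icc J (halfOpenCube_subset_cube J hyJ))
  refine ⟨⟨hy, ?_⟩, hyJ⟩
  rw [← hx1]
  refine (isolationProb_eq p hx hy (m := n) ?_).symm
  rw [(mem_halfOpenCube_iff.1 hyJ).2, (mem_halfOpenCube_iff.1 hxI).2]

/-- The isolation probability is almost everywhere `0` or almost everywhere `1`. -/
theorem isolationProb_ae_eq_zero_or_one [NeZero d] (hN : 2 ≤ N) (p : ℕ → unitInterval) :
    (∀ᵐ x : Fin d → ℝ, x ∈ generic N d → isolationProb (N := N) p x = 0) ∨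
      ∀ᵐ x : Fin d → ℝ, x ∈ generic N d → isolationProb (N := N) p x = 1 := by
  have hA : MeasurableSet {x : Fin d → ℝ | x ∈ generic N d ∧ isolationProb (N := N) p x = 1} :=
    measurableSet_generic.inter (measurable_isolationProb p (measurableSet_singleton 1))
  rcases volume_eq_zero_or_one hN hA (fun x hx => hx.1.1)
    fun n I J => volume_isolationProb_inter_le p I J with h | h
  · left
    filter_upwards [measure_eq_zero_iff_ae_notMem.1 h] with x hx hxg
    exact (isolationProb_eq_zero_or_one p hxg).resolve_right fun h1 => hx ⟨hxg, h1⟩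
  · right
    have h0 : volume (unitCube d \ {x | x ∈ generic N d ∧ isolationProb (N := N) p x = 1}) = 0 := by
      rw [measure_sdiff (fun x hx => hx.1.1) hA.nullMeasurableSet (by simp [h]), h, volume_unitCube,
        tsub_self]
    filter_upwards [measure_eq_zero_iff_ae_notMem.1 h0] with x hx hxg
    by_contra h1
    exact hx ⟨hxg.1, fun h2 => h1 h2.2⟩

end ZeroOne

/-! ### Positive volume on survival -/

section Volume

variable {N d m n : ℕ}

/-- The event `F` depends only on the variables of the cubes of level at most `n`. -/
def DependsUpTo (n : ℕ) (F : Set (Config N d)) : Prop :=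
  ∀ ω ω' : Config N d, (∀ i, i.1 < n → ω i = ω' i) → ω ∈ F → ω' ∈ F

theorem DependsUpTo.inter {F G : Set (Config N d)} (hF : DependsUpTo n F) (hG : DependsUpTo n G) :
    DependsUpTo n (F ∩ G) :=
  fun ω ω' h hω => ⟨hF ω ω' h hω.1, hG ω ω' h hω.2⟩

theorem DependsUpTo.compl {F : Set (Config N d)} (hF : DependsUpTo n F) : DependsUpTo n Fᶜ :=
  fun ω ω' h hω hω' => hω (hF ω' ω (fun i hi => (h i hi).symm) hω')

theorem dependsUpTo_retained (I : Word N d n) :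
    DependsUpTo n {ω : Config N d | Retained ω I} :=
  fun _ _ h hω k hk => (h ⟨k, _⟩ hk).symm.trans (hω k hk)

theorem measurableSet_retained (I : Word N d n) :
    MeasurableSet {ω : Config N d | Retained ω I} := by
  simp only [Retained, Set.ofPred_forall]
  exact .iInter fun k => .iInter fun hk => measurable_pi_apply (X := fun _ : CubeIndex N d => Bool) _
        (measurableSet_singleton true)

/-- An event that has a uniformly positive conditional probability given the variables up to any
level is almost sure. -/
theorem ae_of_forall_mul_le (p : ℕ → unitInterval) {c : ENNReal} (hc : c ≠ 0) (hc' : c ≤ 1)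
    {V : Set (Config N d)} (hV : MeasurableSet V)
    (h : ∀ (n : ℕ) (F : Set (Config N d)), MeasurableSet F → DependsUpTo n F →
      c * law N d p F ≤ law N d p (F ∩ V)) : ∀ᵐ ω ∂(law N d p), ω ∈ V := by
  have hcyl (t : Set (Config N d)) (ht : t ∈ measurableCylinders fun _ : CubeIndex N d => Bool) :
      ∃ n, DependsUpTo n t := by
    obtain ⟨s, S, hS, rfl⟩ := (mem_measurableCylinders t).1 ht
    refine ⟨s.sup Sigma.fst + 1, fun ω ω' hω hmem => ?_⟩
    have : s.restrict ω = s.restrict ω' := by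
      funext i
      exact hω i (Nat.lt_succ_of_le (Finset.le_sup (f := Sigma.fst) i.2))
    rw [mem_cylinder] at hmem ⊢
    rwa [← this]
  refine measure_eq_zero_iff_ae_notMem.1 (?_ : law N d p Vᶜ = 0) |>.mono fun ω hω => by
    simpa using hω
  by_contra hne
  set μ := law N d p
  have hct : c ≠ ⊤ := ne_top_of_le_ne_top ENNReal.one_ne_top hc'
  -- If `Vᶜ` had positive measure, a cylinder `t` would approximate it within `c * μ Vᶜ / 2`. But
  -- `t` depends on finitely many levels, so a share `c` of it lies in `V` and counts towards the
  -- error.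
  obtain ⟨t, ht, hlt⟩ := exists_measure_symmDiff_lt_of_generateFrom_isSetRing (μ := μ)
    (isSetRing_measurableCylinders (α := fun _ : CubeIndex N d => Bool))
    ⟨{Set.univ}, by simp, by
      simpa using univ_mem_measurableCylinders fun _ : CubeIndex N d => Bool, by simp⟩
    (generateFrom_measurableCylinders (α := fun _ : CubeIndex N d => Bool)).symm hV.compl
    (show 0 < c * μ Vᶜ / 2 from ENNReal.half_pos (mul_ne_zero hc hne))
  obtain ⟨n, hn⟩ := hcyl t ht
  have htm : MeasurableSet t := .of_mem_measurableCylinders ht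
  have h1 : μ (t ∩ V) ≤ μ (symmDiff t Vᶜ) := measure_mono fun ω hω => Or.inl ⟨hω.1, fun h => h hω.2⟩
  have h2 : μ Vᶜ ≤ μ t + μ (symmDiff t Vᶜ) := by
    refine (measure_mono fun ω hω => ?_).trans (measure_union_le _ _)
    by_cases hωt : ω ∈ t
    · exact Or.inl hωt
    · exact Or.inr (Or.inr ⟨hω, hωt⟩)
  have h3 : c * μ Vᶜ ≤ μ (symmDiff t Vᶜ) + μ (symmDiff t Vᶜ) :=
    calc c * μ Vᶜ ≤ c * (μ t + μ (symmDiff t Vᶜ)) := by gcongr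
      _ = c * μ t + c * μ (symmDiff t Vᶜ) := mul_add _ _ _
      _ ≤ μ (symmDiff t Vᶜ) + 1 * μ (symmDiff t Vᶜ) := by
        gcongr
        exact (h n t htm hn).trans h1
      _ = _ := by rw [one_mul]
  have h4 := ENNReal.add_lt_add hlt hlt
  rw [ENNReal.add_halves] at h4
  exact absurd h3 (not_le.2 h4)

/-- The probability that the cubes of level above `n` along a line of descent are open is at least
any lower bound of the partial products of the retention probabilities. -/
theorem le_law_open_above {p : ℕ → unitInterval} {c : ℝ}
    (hc : ∀ n, c ≤ ∏ i ∈ Finset.Icc 1 n, (p i : ℝ)) (n : ℕ) (I : ∀ k, Word N d (k + 1)) :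
    ENNReal.ofReal c ≤ law N d p {ω | ∀ k, n ≤ k → ω ⟨k, I k⟩ = true} := by
  classical
  let e : ℕ ↪ CubeIndex N d := ⟨fun k => ⟨k, I k⟩, fun a b h => congrArg Sigma.fst h⟩
  let E : ℕ → Set (Config N d) := fun M => Set.pi ((Finset.Ico n M).map e) fun _ => {true}
  have hE : {ω : Config N d | ∀ k, n ≤ k → ω ⟨k, I k⟩ = true} = ⋂ M, E M := by
    ext ω
    simp only [E, Set.mem_ofPred_eq, Set.mem_iInter, Set.mem_pi, Finset.coe_map, Set.forall_mem_image,
      Finset.coe_Ico, Set.mem_Ico, Set.mem_singleton_iff]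
    exact ⟨fun h M k hk => h k hk.1, fun h k hk => h (k + 1) ⟨hk, k.lt_succ_self⟩⟩
  have hanti : Antitone E := fun a b hab =>
    Set.pi_mono' (fun _ _ => subset_rfl)
      (Finset.coe_subset.2 (Finset.map_subset_map.2 (Finset.Ico_subset_Ico_right hab)))
  have hmeas (M : ℕ) : MeasurableSet (E M) :=
    .pi (Finset.countable_toSet _) fun _ _ => measurableSet_singleton _
  have hprob (M : ℕ) : ENNReal.ofReal c ≤ law N d p (E M) := by
    have h1 : law N d p (E M) = ∏ k ∈ Finset.Ico n M, ENNReal.ofReal (p (k + 1)) := by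
      rw [law, Measure.infinitePi_pi _ fun _ _ => measurableSet_singleton _, Finset.prod_map]
      refine Finset.prod_congr rfl fun k _ => ?_
      rw [bernoulliMeasure_apply_of_mem_of_notMem _ (measurableSet_singleton true) rfl (by simp)]
      exact (ENNReal.ofReal_eq_coe_nnreal (p (k + 1)).2.1).symm
    rw [h1, Finset.prod_Ico_add' (fun k => ENNReal.ofReal (p k))]
    refine (ENNReal.ofReal_le_ofReal (hc M)).trans ?_
    rw [ENNReal.ofReal_prod_of_nonneg fun i _ => (p i).2.1]
    -- Only the factors of levels `n + 1` to `M` occur; the omitted ones are at most 1.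
    refine Finset.prod_le_prod_of_subset_of_le_one' ?_ fun i _ _ => ?_
    · intro i hi
      simp only [Finset.mem_Ico, Finset.mem_Icc] at hi ⊢
      omega
    · exact ENNReal.ofReal_le_one.2 (p i).2.2
  rw [hE]
  exact ge_of_tendsto (tendsto_measure_iInter_atTop (fun M => (hmeas M).nullMeasurableSet) hanti
    ⟨0, measure_ne_top _ _⟩) (Filter.Eventually.of_forall hprob)

variable [NeZero N]

/-- The generic points of the limit set. -/
def genericLimit (ω : Config N d) : Set (Fin d → ℝ) :=
  {x | x ∈ generic N d ∧ ∀ n, Retained ω (word N n x)}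

/-- The generic part is described by digits and retention, so it is jointly measurable in point and
configuration. -/
theorem volume_limitSet (ω : Config N d) : volume (limitSet ω) = volume (genericLimit ω) := by
  refine measure_congr ?_
  filter_upwards [ae_mem_generic (N := N)] with x hx
  refine propext ⟨fun h => ?_, fun h => (mem_limitSet_iff h.1).2 h.2⟩
  have := hx (limitSet_subset_Icc ω h)
  exact ⟨this, (mem_limitSet_iff this).1 h⟩

theorem measurableSet_genericLimit :
    MeasurableSet {z : (Fin d → ℝ) × Config N d | z.1 ∈ genericLimit z.2} := by
  have : {z : (Fin d → ℝ) × Config N d | z.1 ∈ genericLimit z.2} = Prod.fst ⁻¹' generic N d ∩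
      ⋂ n, ⋃ I : Word N d n, Prod.fst ⁻¹' (word N n ⁻¹' {I}) ∩ Prod.snd ⁻¹' {ω | Retained ω I} := by
    ext z
    simp [genericLimit]
  rw [this]
  exact (measurable_fst measurableSet_generic).inter <| .iInter fun n => .iUnion fun I =>
    (measurable_fst (measurableSet_preimage_word I)).inter (measurable_snd (measurableSet_retained I))

theorem measurableSet_volume_limitSet_pos :
    MeasurableSet {ω : Config N d | 0 < volume (limitSet ω)} := by
  simp only [volume_limitSet]
  have : Measurable fun ω : Config N d => volume (genericLimit ω) :=
    measurable_measure_prodMk_right measurableSet_genericLimit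
  exact measurableSet_lt measurable_const this

variable {p : ℕ → unitInterval} {c : ℝ}

/-- On `F`, each generic `x` in the cube survives as soon as the cubes around it above level `n` are
open, which is independent of `F` and has probability at least `c`. Integrating over `x`, and
bounding the volume captured by that of the cube wherever it is positive, gives the claim. -/
theorem mul_le_law_inter_of_subset_retained (hc : ∀ n, c ≤ ∏ i ∈ Finset.Icc 1 n, (p i : ℝ))
    {F : Set (Config N d)} (hF : MeasurableSet F) (hFn : DependsUpTo n F) (I : Word N d n)
    (hFI : ∀ ω ∈ F, Retained ω I) :
    ENNReal.ofReal c * law N d p F ≤ law N d p (F ∩ {ω | 0 < volume (limitSet ω)}) := by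
  have hpath (x : Fin d → ℝ) (hx : x ∈ generic N d) (hxI : x ∈ halfOpenCube I) :
      ENNReal.ofReal c * law N d p F ≤ law N d p (F ∩ {ω | x ∈ genericLimit ω}) := by
    have hE : MeasurableSet {ω : Config N d | ∀ k, n ≤ k → ω ⟨k, word N (k + 1) x⟩ = true} := by
      simp only [Set.ofPred_forall]
      exact .iInter fun k => .iInter fun _ => measurable_pi_apply (X := fun _ : CubeIndex N d => Bool) _
        (measurableSet_singleton true)
    have hind := law_inter_eq_mul p (S := {i : CubeIndex N d | i.1 < n}) (T := {i | n ≤ i.1})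
      (Set.disjoint_left.2 fun i (hi : i.1 < n) hi' => absurd hi (not_lt.2 hi')) hF hE hFn
      (fun ω ω' h hω k hk => (h ⟨k, _⟩ hk).symm.trans (hω k hk))
    rw [mul_comm]
    calc law N d p F * ENNReal.ofReal c ≤ _ := mul_le_mul_right (le_law_open_above hc n _) _
      _ = _ := hind.symm
      _ ≤ _ := by
        refine measure_mono fun ω hω => ⟨hω.1, hx, fun k j hj => ?_⟩
        by_cases hjn : n ≤ j
        · exact hω.2 j hjn
        · have := hFI ω hω.1 j (by omega)
          rwa [← (mem_halfOpenCube_iff.1 hxI).2] at this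
  classical
  set Z : Set ((Fin d → ℝ) × Config N d) :=
    {z | z.1 ∈ genericLimit z.2} ∩ halfOpenCube I ×ˢ F with hZ
  have hZm : MeasurableSet Z :=
    measurableSet_genericLimit.inter ((measurableSet_halfOpenCube I).prod hF)
  have hlow : ENNReal.ofReal c * law N d p F * volume (halfOpenCube I) ≤
      (volume.prod (law N d p)) Z := by
    rw [Measure.prod_apply hZm, ← setLIntegral_const]
    refine (lintegral_mono_ae ?_).trans (setLIntegral_le_lintegral (halfOpenCube I) _)
    refine (ae_restrict_iff' (measurableSet_halfOpenCube I)).2 ?_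
    filter_upwards [ae_mem_generic (N := N)] with x hx hxI
    have hxg := hx (cube_subset_Icc I (halfOpenCube_subset_cube I hxI))
    refine (hpath x hxg hxI).trans (measure_mono fun ω hω => ⟨hω.2, hxI, hω.1⟩)
  have hup : (volume.prod (law N d p)) Z ≤
      law N d p (F ∩ {ω | 0 < volume (limitSet ω)}) * volume (halfOpenCube I) := by
    rw [Measure.prod_apply_symm hZm, mul_comm, ← setLIntegral_const, ← lintegral_indicator
      (hF.inter measurableSet_volume_limitSet_pos)]
    refine lintegral_mono fun ω => ?_
    rw [Set.indicator_apply]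
    split_ifs with hω
    · exact measure_mono fun x hx => hx.2.1
    · by_cases hωF : ω ∈ F
      · have : volume (limitSet ω) = 0 := by
          by_contra h0
          exact hω ⟨hωF, pos_iff_ne_zero.2 h0⟩
        rw [volume_limitSet] at this
        exact (measure_mono_null (fun x hx => hx.1) this).le
      · have : (fun x => (x, ω)) ⁻¹' Z = ∅ := by
          ext x
          simp [hZ, hωF]
        simp [this]
  have hvol : volume (halfOpenCube I) ≠ 0 := by
    have := base_pos (N := N)
    rw [volume_halfOpenCube]
    exact pow_ne_zero _ (ENNReal.ofReal_pos.2 (by positivity)).ne'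
  have hvol' : volume (halfOpenCube I) ≠ ⊤ := by
    rw [volume_halfOpenCube]
    exact ENNReal.pow_ne_top ENNReal.ofReal_ne_top
  exact (ENNReal.mul_le_mul_iff_left hvol hvol').1 (hlow.trans hup)

/-- Split `F` according to whether a given cube is retained; both parts still depend only on levels
up to `n`. -/
theorem mul_le_law_inter (hc : ∀ n, c ≤ ∏ i ∈ Finset.Icc 1 n, (p i : ℝ)) (S : Finset (Word N d n))
    {F : Set (Config N d)} (hF : MeasurableSet F) (hFn : DependsUpTo n F)
    (hFS : ∀ ω ∈ F, ∃ I ∈ S, Retained ω I) :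
    ENNReal.ofReal c * law N d p F ≤ law N d p (F ∩ {ω | 0 < volume (limitSet ω)}) := by
  classical
  induction S using Finset.induction_on generalizing F with
  | empty =>
    have : F = ∅ := Set.eq_empty_of_forall_notMem fun ω hω => by simpa using hFS ω hω
    simp [this]
  | insert I S _ ih =>
    have h1 := mul_le_law_inter_of_subset_retained (p := p) hc (hF.inter (measurableSet_retained I))
      (hFn.inter (dependsUpTo_retained I)) I fun ω hω => hω.2
    have h2 := ih (hF.inter (measurableSet_retained I).compl)
      (hFn.inter (dependsUpTo_retained I).compl) fun ω hω => by
        obtain ⟨J, hJ, hJr⟩ := hFS ω hω.1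
        rcases Finset.mem_insert.1 hJ with rfl | hJS
        · exact absurd hJr hω.2
        · exact ⟨J, hJS, hJr⟩
    rw [← measure_inter_add_sdiff F (measurableSet_retained I), mul_add,
      ← measure_inter_add_sdiff (F ∩ {ω | 0 < volume (limitSet ω)}) (measurableSet_retained I),
      Set.sdiff_eq, Set.sdiff_eq,
      Set.inter_right_comm F {ω | 0 < _},
      Set.inter_right_comm F {ω | 0 < _}]
    exact add_le_add h1 h2

/-- Given non-extinction, the limit set almost surely has positive volume. -/
theorem ae_volume_limitSet_pos (hc0 : 0 < c) (hc : ∀ n, c ≤ ∏ i ∈ Finset.Icc 1 n, (p i : ℝ)) :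
    ∀ᵐ ω ∂(law N d p), (limitSet ω).Nonempty → 0 < volume (limitSet ω) := by
  have hmono {n : ℕ} : MeasurableSet {ω : Config N d | ∃ I : Word N d n, Retained ω I} := by
    simp only [Set.ofPred_exists]
    exact .iUnion fun I => measurableSet_retained I
  have hdep {n : ℕ} : DependsUpTo n {ω : Config N d | ∃ I : Word N d n, Retained ω I} :=
    fun ω ω' h ⟨I, hI⟩ => ⟨I, dependsUpTo_retained I ω ω' h hI⟩
  have hae := ae_of_forall_mul_le p (c := ENNReal.ofReal c) (ENNReal.ofReal_pos.2 hc0).ne'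
    (ENNReal.ofReal_le_one.2 (by simpa using hc 0))
    -- Configurations with no retained cube at some level are added to `V`, so the part of `F`
    -- without retained level-`n` cubes lies in `V` entirely.
    (V := {ω : Config N d | 0 < volume (limitSet ω)} ∪ ⋃ n, {ω | ∃ I : Word N d n, Retained ω I}ᶜ)
    (measurableSet_volume_limitSet_pos.union (.iUnion fun n => hmono.compl)) ?_
  · filter_upwards [hae] with ω hω ⟨x, hx⟩
    refine hω.resolve_right fun hex => ?_
    obtain ⟨n, hn⟩ := Set.mem_iUnion.1 hex
    rw [limitSet_eq_iInter] at hx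
    obtain ⟨I, hI, -⟩ := Set.mem_iUnion₂.1 (Set.mem_iInter.1 hx n)
    exact hn ⟨I, hI⟩
  · intro n F hF hFn
    have h1 := mul_le_law_inter hc Finset.univ (hF.inter (hmono (n := n))) (hFn.inter hdep)
      fun ω ⟨_, I, hI⟩ => ⟨I, Finset.mem_univ _, hI⟩
    rw [← measure_inter_add_sdiff F (hmono (n := n)), mul_add,
      ← measure_inter_add_sdiff
        (F ∩ ({ω | 0 < volume (limitSet ω)} ∪ ⋃ n, {ω | ∃ I : Word N d n, Retained ω I}ᶜ))
        (hmono (n := n)) (μ := law N d p)]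
    refine add_le_add (h1.trans (measure_mono fun ω hω => ⟨⟨hω.1.1, Or.inl hω.2⟩, hω.1.2⟩)) ?_
    refine (mul_le_of_le_one_left' (ENNReal.ofReal_le_one.2 (by simpa using hc 0))).trans ?_
    exact measure_mono fun ω hω => ⟨⟨hω.1, Or.inr (Set.mem_iUnion.2 ⟨n, hω.2⟩)⟩, hω.2⟩

theorem law_volume_limitSet_pos (hc0 : 0 < c) (hc : ∀ n, c ≤ ∏ i ∈ Finset.Icc 1 n, (p i : ℝ)) :
    0 < law N d p {ω | 0 < volume (limitSet ω)} := by
  -- At level 0 the empty word is always retained and no conditioning is needed.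
  have := mul_le_law_inter_of_subset_retained (N := N) (d := d) (p := p) hc .univ
    (fun _ _ _ _ => trivial) (fun j : Fin 0 => j.elim0) fun ω _ k hk => absurd hk (by omega)
  rw [Set.univ_inter, measure_univ, mul_one] at this
  exact (ENNReal.ofReal_pos.2 hc0).trans_le this

end Volume

/-! ### Fubini and the dichotomy -/

section Conclusion

variable {N d : ℕ} [NeZero N]

/-- Fubini is applied to `Z`, so that `B`, here the dust set or its complement in the limit set,
needs no measurability of its own. -/
theorem ae_volume_eq_zero_of_ae_law {p : ℕ → unitInterval} {B : Config N d → Set (Fin d → ℝ)}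
    {Z : Set ((Fin d → ℝ) × Config N d)} (hZ : MeasurableSet Z)
    (hB : ∀ ω, ∀ x ∈ generic N d, x ∈ B ω → (x, ω) ∈ Z) (hBD : ∀ ω, B ω ⊆ limitSet ω)
    (h : ∀ᵐ x : Fin d → ℝ, x ∈ generic N d → law N d p {ω | (x, ω) ∈ Z} = 0) :
    ∀ᵐ ω ∂(law N d p), volume (B ω) = 0 := by
  have hZ' : MeasurableSet (Prod.fst ⁻¹' generic N d ∩ Z) :=
    (measurable_fst measurableSet_generic).inter hZ
  have h0 : (volume.prod (law N d p)) (Prod.fst ⁻¹' generic N d ∩ Z) = 0 := by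
    rw [Measure.measure_prod_null hZ']
    filter_upwards [h] with x hx
    by_cases hxg : x ∈ generic N d
    · exact measure_mono_null (fun ω hω => hω.2) (hx hxg)
    · exact measure_mono_null (fun ω hω => hxg hω.1) measure_empty
  rw [Measure.prod_apply_symm hZ',
    lintegral_eq_zero_iff (measurable_measure_prodMk_right hZ')] at h0
  filter_upwards [h0] with ω hω
  refine measure_mono_null_ae ?_ hω
  filter_upwards [ae_mem_generic (N := N)] with x hx hxB
  have hxg := hx (limitSet_subset_Icc ω (hBD ω hxB))
  exact ⟨hxg, hB ω x hxg hxB⟩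

theorem ae_volume_dustSet_eq_zero_or [NeZero d] (hN : 2 ≤ N) (p : ℕ → unitInterval) :
    (∀ᵐ ω ∂(law N d p), volume (dustSet ω) = 0) ∨
      ∀ᵐ ω ∂(law N d p), volume (connectedSet ω) = 0 := by
  refine (isolationProb_ae_eq_zero_or_one (N := N) (d := d) hN p).imp (fun h => ?_) fun h => ?_
  · refine ae_volume_eq_zero_of_ae_law measurableSet_isolated_openAlong (fun ω x hxg hx => ?_)
      (fun ω x hx => hx.1) h
    exact (connectedComponentIn_eq_singleton_iff hN hxg hx.1).1 hx.2
  · refine ae_volume_eq_zero_of_ae_law measurableSet_isolated_openAlong.compl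
      (fun ω x hxg hx hi => ?_) (fun ω x hx => hx.1) ?_
    · exact hx.2 ⟨hx.1, (connectedComponentIn_eq_singleton_iff hN hxg hx.1).2 hi⟩
    · filter_upwards [h] with x hx hxg
      exact (prob_compl_eq_zero_iff (measurableSet_isolated_openAlong_right x)).2 (hx hxg)

omit [NeZero N] in
theorem volume_limitSet_le (ω : Config N d) :
    volume (limitSet ω) ≤ volume (dustSet ω) + volume (connectedSet ω) :=
  (measure_mono fun _ hx => or_iff_not_imp_left.2 fun h => ⟨hx, h⟩).trans
    (measure_union_le (dustSet ω) (connectedSet ω))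

end Conclusion

end FatFractal

theorem theorem4 (N d : ℕ) (hN : 2 ≤ N) (hd : 2 ≤ d) (p : ℕ → unitInterval)
    (hp_pos : ∀ n, 1 ≤ n → 0 < p n)
    (hp_mono : ∀ m n, 1 ≤ m → m ≤ n → p m ≤ p n)
    (hp_prod : ∃ c : ℝ, 0 < c ∧
      Filter.Tendsto (fun n : ℕ => ∏ i ∈ Finset.Icc 1 n, (p i : ℝ)) Filter.atTop (nhds c)) :
    Xor
      (∀ᵐ ω ∂(FatFractal.law N d p), (FatFractal.limitSet ω).Nonempty →
        MeasureTheory.volume (FatFractal.dustSet ω) = 0 ∧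
          0 < MeasureTheory.volume (FatFractal.connectedSet ω))
      (∀ᵐ ω ∂(FatFractal.law N d p), (FatFractal.limitSet ω).Nonempty →
        0 < MeasureTheory.volume (FatFractal.dustSet ω) ∧
          MeasureTheory.volume (FatFractal.connectedSet ω) = 0) := by
  have : NeZero N := ⟨by omega⟩
  have : NeZero d := ⟨by omega⟩
  obtain ⟨c, hc0, hlim⟩ := hp_prod
  have hanti : Antitone fun n : ℕ => ∏ i ∈ Finset.Icc 1 n, (p i : ℝ) := by
    refine antitone_nat_of_succ_le fun n => ?_
    rw [Finset.prod_Icc_succ_top (Nat.le_add_left 1 n)]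
    exact mul_le_of_le_one_right (Finset.prod_nonneg fun i _ => (p i).2.1) (p (n + 1)).2.2
  have hc : ∀ n, c ≤ ∏ i ∈ Finset.Icc 1 n, (p i : ℝ) := fun n => hanti.le_of_tendsto hlim n
  have hpos := FatFractal.ae_volume_limitSet_pos (N := N) (d := d) hc0 hc
  refine (xor_iff_or_and_not_and _ _).2 ⟨?_, fun ⟨h1, h2⟩ => ?_⟩
  · refine (FatFractal.ae_volume_dustSet_eq_zero_or (d := d) hN p).imp (fun h => ?_) fun h => ?_
    · filter_upwards [h, hpos] with ω h0 hω hne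
      refine ⟨h0, (hω hne).trans_le ?_⟩
      simpa [h0] using FatFractal.volume_limitSet_le ω
    · filter_upwards [h, hpos] with ω h0 hω hne
      refine ⟨(hω hne).trans_le ?_, h0⟩
      simpa [h0] using FatFractal.volume_limitSet_le ω
  -- If both statements held, positive volume, which forces survival, would make the dust set both
  -- null and not null; so positive volume would have probability 0.
  · refine (FatFractal.law_volume_limitSet_pos (N := N) (d := d) hc0 hc).ne' ?_
    refine MeasureTheory.measure_eq_zero_iff_ae_notMem.2 ?_
    filter_upwards [h1, h2] with ω hω1 hω2 (hω : 0 < MeasureTheory.volume (FatFractal.limitSet ω))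
    have hne := MeasureTheory.nonempty_of_measure_ne_zero hω.ne'
    exact (hω2 hne).1.ne' (hω1 hne).1
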